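/- Let $(\Omega,\mathcal F,P)$ be a probability space. Let $L^\infty_{++}$ be the set of ($P$-a.s. equivalence classes of) essentially bounded random variables $X$ for which there is a constant $c>0$ with $X\ge c$ $P$-a.s. (equivalently, $X>0$ $P$-a.s. and $X,\log X\in L^\infty$), and let $\mathcal Q$ be the set of all probability measures $Q\ll P$ on $(\Omega,\mathcal F)$. A map $\tilde\rho:L^\infty_{++}\to[0,\infty]$ is called - monotone if $X\le Y$ $P$-a.s. implies $\tilde\rho(X)\le\tilde\rho(Y)$; - quasi-logconvex if $\tilde\rho(X^\alpha Y^{1-\alpha})\le\max\{\tilde\rho(X),\tilde\rho(Y)\}$ for all $X,Y\in L^\infty_{++}$ and $\alpha\in(0,1)$; - continuous from below if $\tilde\rho(X_n)\to\tilde\rho(X)$ whenever $X_n,X\in L^\infty_{++}$ and $X_n\uparrow X$ $P$-a.s. A function $f$ of a real variable is called continuous from below if $f(t_n)\to f(t)$ whenever $t_n\uparrow t$. We use $\exp(-\infty)=0$, $\exp(+\infty)=+\infty$, $\log 0=-\infty$, $\log(+\infty)=+\infty$, and for $Q\in\mathcal Q$, $X\in L^\infty_{++}$ we put $$H_{0,Q}(X)=\inf\{k>0:\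 \mathbb E_Q[\log(X/k)]\le 0\}\in(0,\infty).$$ Let $\tilde\rho:L^\infty_{++}\to[0,\infty]$. (1) $\tilde\rho$ is monotone, quasi-logconvex and continuous from below if and only if there is a functional $\mathfrak R:\mathbb R\times\mathcal Q\to[-\infty,\infty]$ such that $t\mapsto\mathfrak R(t;Q)$ is increasing and continuous from below for every $Q\in\mathcal Q$, and $$\tilde\rho(X)=\sup_{Q\in\mathcal Q}\exp\bigl(\mathfrak R(\mathbb E_Q[\log X];Q)\bigr)\qquad\text{for all }X\in L^\infty_{++}.\tag{$*$}$$ (2) If $\tilde\rho$ is monotone, quasi-logconvex and continuous from below, then $(*)$ holds with the explicit functional $$\mathfrak R_{\tilde\rho}(t;Q)=\inf\{\log\tilde\rho(Y):\ Y\in L^\infty_{++},\ \mathbb E_Q[\log Y]\ge t\},$$ which is increasing in $t$. Its left-limit version $\mathfrak R_{\tilde\rho}^-(t;Q)=\sup_{s<t}\mathfrak R_{\tilde\rho}(s;Q)$ is increasing and continuous from below in $t$, and $(*)$ also holds with $\mathfrak R=\mathfrak R_{\tilde\rho}^-$. (3) $\tilde\rho$ is monotone, quasi-logconvex and continuous from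 below if and only if there is a function $R:(0,\infty)\times\mathcal Q\to[0,\infty]$ such that $s\mapsto R(s;Q)$ is increasing and continuous from below for every $Q\in\mathcal Q$, and $$\tilde\rho(X)=\sup_{Q\in\mathcal Q}R\bigl(H_{0,Q}(X);Q\bigr)\qquad\text{for all }X\in L^\infty_{++}.\tag{$**$}$$ The two representations correspond to each other: a functional $\mathfrak R:\mathbb R\times\mathcal Q\to[-\infty,\infty]$ satisfies $(*)$ if and only if $R(s;Q)=\exp(\mathfrak R(\log s;Q))$ satisfies $(**)$. -/

import Mathlib

open MeasureTheory Filter Topology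
open scoped ENNReal

noncomputable section

namespace QuasiLogconvex

variable {Ω : Type*} [MeasurableSpace Ω]

/-- `L^∞_{++}(Ω, F, P)`: the (classes of) essentially bounded random variables that are strictly
positive in the sense of being `P`-a.s. bounded below by some constant `c > 0`. Equivalently, these
are the `X` with `log X ∈ L^∞`, i.e. `L^∞_{++} = exp (L^∞)`. -/
abbrev LInftyPP (P : Measure Ω) : Type _ :=
  {X : Lp ℝ ∞ P // ∃ c : ℝ, 0 < c ∧ ∀ᵐ ω ∂P, c ≤ X ω}

/-- The set `𝒬` of all probability measures that are absolutely continuous with respect to `P`. -/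
abbrev ACProb (P : Measure Ω) : Type _ :=
  {Q : ProbabilityMeasure Ω // (Q : Measure Ω) ≪ P}

/-- The random variable underlying an element of `L^∞_{++}`. -/
def LInftyPP.rv {P : Measure Ω} (X : LInftyPP P) (ω : Ω) : ℝ := (X : Lp ℝ ∞ P) ω

/-- The measure underlying an element of `𝒬`. -/
def ACProb.meas {P : Measure Ω} (Q : ACProb P) : Measure Ω := ((Q : ProbabilityMeasure Ω) : Measure Ω)

instance ACProb.isProbabilityMeasure_meas {P : Measure Ω} (Q : ACProb P) : IsProbabilityMeasure Q.meas := by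
  unfold ACProb.meas; infer_instance

theorem LInftyPP.aestronglyMeasurable {P : Measure Ω} (X : LInftyPP P) :
    AEStronglyMeasurable (LInftyPP.rv X) P :=
  Lp.aestronglyMeasurable (X : Lp ℝ ∞ P)

theorem LInftyPP.exists_bounds {P : Measure Ω} (X : LInftyPP P) :
    ∃ a b : ℝ, 0 < a ∧ 0 < b ∧ ∀ᵐ ω ∂P, a ≤ LInftyPP.rv X ω ∧ LInftyPP.rv X ω ≤ b := by
  obtain ⟨a, ha, hX⟩ := X.2
  refine ⟨a, ‖(X : Lp ℝ ∞ P)‖ + 1, ha, by positivity, ?_⟩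
  filter_upwards [hX, ae_le_eLpNormEssSup (f := (X : Lp ℝ ∞ P)) (μ := P)] with ω h1 h2
  refine ⟨h1, ?_⟩
  have h3 : ‖(X : Lp ℝ ∞ P) ω‖ ≤ ‖(X : Lp ℝ ∞ P)‖ := by
    rw [Lp.norm_def, eLpNorm_exponent_top]
    have hfin : eLpNormEssSup (X : Lp ℝ ∞ P) P ≠ ∞ := by
      have := Lp.eLpNorm_ne_top (X : Lp ℝ ∞ P)
      rwa [eLpNorm_exponent_top] at this
    have := ENNReal.toReal_mono hfin h2
    simpa using this
  have h4 := le_abs_self ((X : Lp ℝ ∞ P) ω)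
  rw [Real.norm_eq_abs] at h3
  show (X : Lp ℝ ∞ P) ω ≤ _
  linarith

theorem memLp_top_of_bounds {P : Measure Ω} [IsFiniteMeasure P] {f : Ω → ℝ}
    (hf : AEStronglyMeasurable f P) (h : ∃ a b : ℝ, 0 < a ∧ ∀ᵐ ω ∂P, a ≤ f ω ∧ f ω ≤ b) :
    MemLp f ∞ P := by
  obtain ⟨a, b, ha, hab⟩ := h
  refine memLp_top_of_bound hf b ?_
  filter_upwards [hab] with ω hω
  rw [Real.norm_eq_abs, abs_of_nonneg (ha.le.trans hω.1)]
  exact hω.2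

/-- The class in `L^∞_{++}` of a random variable with values a.s. in `[a, b]`, where `0 < a`. -/
def LInftyPP.mk {P : Measure Ω} [IsFiniteMeasure P] (f : Ω → ℝ) (hf : AEStronglyMeasurable f P)
    (h : ∃ a b : ℝ, 0 < a ∧ ∀ᵐ ω ∂P, a ≤ f ω ∧ f ω ≤ b) : LInftyPP P :=
  ⟨(memLp_top_of_bounds hf h).toLp f, by
    obtain ⟨a, b, ha, hab⟩ := id h
    refine ⟨a, ha, ?_⟩
    filter_upwards [hab, (memLp_top_of_bounds hf h).coeFn_toLp] with ω h1 h2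
    rw [h2]
    exact h1.1⟩

theorem LInftyPP.mk_rv {P : Measure Ω} [IsFiniteMeasure P] (f : Ω → ℝ)
    (hf : AEStronglyMeasurable f P) (h : ∃ a b : ℝ, 0 < a ∧ ∀ᵐ ω ∂P, a ≤ f ω ∧ f ω ≤ b) :
    LInftyPP.rv (LInftyPP.mk f hf h) =ᵐ[P] f :=
  (memLp_top_of_bounds hf h).coeFn_toLp

/-- The weighted geometric mean `X^α Y^(1-α)` of two elements of `L^∞_{++}`. -/
def geomMean {P : Measure Ω} [IsFiniteMeasure P] (X Y : LInftyPP P) (α : Set.Ioo (0 : ℝ) 1) :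
    LInftyPP P :=
  LInftyPP.mk (fun ω => LInftyPP.rv X ω ^ (α : ℝ) * LInftyPP.rv Y ω ^ (1 - (α : ℝ)))
    (((X.aestronglyMeasurable.aemeasurable.pow_const _).mul
      (Y.aestronglyMeasurable.aemeasurable.pow_const _)).aestronglyMeasurable)
    (by
      obtain ⟨a, b, ha, hb, hX⟩ := X.exists_bounds
      obtain ⟨c, d, hc, hd, hY⟩ := Y.exists_bounds
      have h0 : (0 : ℝ) ≤ α := α.2.1.le
      have h1 : (0 : ℝ) ≤ 1 - (α : ℝ) := sub_nonneg.2 α.2.2.le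
      refine ⟨a ^ (α : ℝ) * c ^ (1 - (α : ℝ)), b ^ (α : ℝ) * d ^ (1 - (α : ℝ)),
        by positivity, ?_⟩
      filter_upwards [hX, hY] with ω hx hy
      have hx0 : 0 ≤ LInftyPP.rv X ω := ha.le.trans hx.1
      have hy0 : 0 ≤ LInftyPP.rv Y ω := hc.le.trans hy.1
      constructor
      · exact mul_le_mul (Real.rpow_le_rpow ha.le hx.1 h0) (Real.rpow_le_rpow hc.le hy.1 h1)
          (by positivity) (by positivity)
      · exact mul_le_mul (Real.rpow_le_rpow hx0 hx.2 h0) (Real.rpow_le_rpow hy0 hy.2 h1)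
          (by positivity) (by positivity))

/-- `X ≤ Y` `P`-a.s. implies `ρ(X) ≤ ρ(Y)`. -/
def IsMonotone {P : Measure Ω} (ρ : LInftyPP P → ℝ≥0∞) : Prop :=
  ∀ X Y : LInftyPP P, LInftyPP.rv X ≤ᵐ[P] LInftyPP.rv Y → ρ X ≤ ρ Y

/-- `ρ(X^α Y^(1-α)) ≤ max (ρ(X), ρ(Y))` for all `X, Y ∈ L^∞_{++}` and `α ∈ (0, 1)`. -/
def IsQuasiLogconvex {P : Measure Ω} [IsFiniteMeasure P] (ρ : LInftyPP P → ℝ≥0∞) : Prop :=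
  ∀ (X Y : LInftyPP P) (α : Set.Ioo (0 : ℝ) 1), ρ (geomMean X Y α) ≤ max (ρ X) (ρ Y)

/-- `X_n ↑ X` `P`-a.s. implies `ρ(X_n) → ρ(X)`. -/
def IsContinuousFromBelow {P : Measure Ω} (ρ : LInftyPP P → ℝ≥0∞) : Prop :=
  ∀ (X : ℕ → LInftyPP P) (X' : LInftyPP P),
    (∀ᵐ ω ∂P, Monotone (fun n => LInftyPP.rv (X n) ω) ∧
      Tendsto (fun n => LInftyPP.rv (X n) ω) atTop (𝓝 (LInftyPP.rv X' ω))) →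
    Tendsto (fun n => ρ (X n)) atTop (𝓝 (ρ X'))

/-- Continuity from below of a function on an interval of reals: `t_n ↑ t` implies
`f(t_n) → f(t)`. -/
def ContFromBelow {α β : Type*} [Preorder α] [TopologicalSpace α] [TopologicalSpace β]
    (f : α → β) : Prop :=
  ∀ (u : ℕ → α) (t : α), Monotone u → Tendsto u atTop (𝓝 t) →
    Tendsto (fun n => f (u n)) atTop (𝓝 (f t))

/-- `E_Q[log X]`. -/
def expLog {P : Measure Ω} (Q : ACProb P) (X : LInftyPP P) : ℝ :=
  ∫ ω, Real.log (LInftyPP.rv X ω) ∂Q.meas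

/-- The logarithmic Orlicz premium
`H_{0,Q}(X) = inf {k > 0 | E_Q[log (X / k)] ≤ 0}`. -/
def orliczPremium {P : Measure Ω} (Q : ACProb P) (X : LInftyPP P) : ℝ :=
  sInf {k : ℝ | 0 < k ∧ ∫ ω, Real.log (LInftyPP.rv X ω / k) ∂Q.meas ≤ 0}

theorem orliczPremium_pos {P : Measure Ω} (Q : ACProb P) (X : LInftyPP P) :
    0 < orliczPremium Q X := by
  obtain ⟨a, b, ha, hb, hX⟩ := X.exists_bounds
  have hac : Q.meas ≪ P := Q.2
  have hXQ := hac.ae_le hX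
  have hmeas : AEMeasurable (LInftyPP.rv X) Q.meas :=
    X.aestronglyMeasurable.aemeasurable.mono_ac hac
  refine lt_of_lt_of_le ha (le_csInf ⟨b, hb, ?_⟩ ?_)
  · refine integral_nonpos_of_ae ?_
    filter_upwards [hXQ] with ω hω
    exact Real.log_nonpos (div_nonneg (ha.le.trans hω.1) hb.le) ((div_le_one hb).2 hω.2)
  · rintro k ⟨hk, hint⟩
    by_contra! hka
    have hI : Integrable (fun ω => Real.log (LInftyPP.rv X ω / k)) Q.meas := by
      refine Integrable.of_bound (Real.measurable_log.comp_aemeasurable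
        (hmeas.div_const k)).aestronglyMeasurable (Real.log (b / k)) ?_
      filter_upwards [hXQ] with ω hω
      have h1 : 1 ≤ LInftyPP.rv X ω / k := (one_le_div hk).2 (hka.le.trans hω.1)
      rw [Real.norm_eq_abs, abs_of_nonneg (Real.log_nonneg h1)]
      exact Real.log_le_log (by linarith) (by gcongr; exact hω.2)
    have hle : Real.log (a / k) ≤ ∫ ω, Real.log (LInftyPP.rv X ω / k) ∂Q.meas := by
      have := integral_mono_ae (integrable_const (Real.log (a / k)) (μ := Q.meas)) hI (by
        filter_upwards [hXQ] with ω hω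
        exact Real.log_le_log (by positivity) (by gcongr; exact hω.1))
      simpa using this
    have hpos : 0 < Real.log (a / k) := Real.log_pos ((one_lt_div hk).2 hka)
    linarith

/-- `H_{0,Q}(X)` as an element of `(0, ∞)`. -/
def orliczPremiumPos {P : Measure Ω} (Q : ACProb P) (X : LInftyPP P) : Set.Ioi (0 : ℝ) :=
  ⟨orliczPremium Q X, orliczPremium_pos Q X⟩

/-- `ρ(X) = sup_{Q ∈ 𝒬} exp (𝔑(E_Q[log X]; Q))` for all `X ∈ L^∞_{++}`, where
`exp (-∞) = 0` and `exp (+∞) = +∞`. -/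
def RepresentedBy {P : Measure Ω} (ρ : LInftyPP P → ℝ≥0∞) (N : ℝ → ACProb P → EReal) : Prop :=
  ∀ X : LInftyPP P, ρ X = ⨆ Q : ACProb P, EReal.exp (N (expLog Q X) Q)

/-- `ρ(X) = sup_{Q ∈ 𝒬} R(H_{0,Q}(X); Q)` for all `X ∈ L^∞_{++}`. -/
def OrliczRepresentedBy {P : Measure Ω} (ρ : LInftyPP P → ℝ≥0∞)
    (R : Set.Ioi (0 : ℝ) → ACProb P → ℝ≥0∞) : Prop :=
  ∀ X : LInftyPP P, ρ X = ⨆ Q : ACProb P, R (orliczPremiumPos Q X) Q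

/-- `𝔑_ρ(t; Q) = inf {log ρ(Y) : Y ∈ L^∞_{++}, E_Q[log Y] ≥ t}`, where `log 0 = -∞`. -/
def dualFn {P : Measure Ω} (ρ : LInftyPP P → ℝ≥0∞) (t : ℝ) (Q : ACProb P) : EReal :=
  ⨅ (Y : LInftyPP P) (_ : t ≤ expLog Q Y), ENNReal.log (ρ Y)

/-- The left-limit version `𝔑⁻(t; Q) = sup_{s < t} 𝔑(s; Q)` of a functional increasing in `t`. -/
def leftReg {P : Measure Ω} (N : ℝ → ACProb P → EReal) (t : ℝ) (Q : ACProb P) : EReal :=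
  ⨆ (s : ℝ) (_ : s < t), N s Q

end QuasiLogconvex

end

/-! ### Elementary half: properties of represented functionals, Orlicz premia, left limits. -/

namespace QuasiLogconvex

variable {Ω : Type*} [MeasurableSpace Ω] {P : Measure Ω}

/-! After the substitution `u = log X`, geometric means become convex combinations, and each set `{u
| ρ (exp u) ≤ c}` is convex and downward closed. Continuity from below makes it closed under bounded
a.s. limits (`isBddAEClosed_logLevelSet`). If `c < ρ X`, then `log X` lies outside this set, and a
probability `Q ≪ P` separates it strictly from the set (`exists_separating_acProb`). Hence every `Y`
with `E_Q[log Y]` close enough to `E_Q[log X]`, or larger, has `ρ Y > c`, so already the left-limit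
version of `dualFn` is at least `log c` at `E_Q[log X]`. The reverse bound is trivial since `Y = X`
competes in the infimum; both explicit representations follow.

The hard point is that the separating functional must come from a measure, not merely from the norm
dual of `L^∞`. As in the Krein–Šmulian theorem, the convex set `D` of differences, which misses `0`,
is kept away from a whole neighbourhood `{u | E[(u - n)⁺] ≤ δ n for all n}` of `0`, with the `δ n`
chosen one at a time by weak compactness of nested convex sets in `L²`
(`exists_disjoint_excessSet`). A Hahn–Banach functional bounded above on this neighbourhood is
positive and small on indicators of small sets, hence is integration against a finite measure.

The converse holds because `E_Q[log ·]` is monotone, affine along geometric means and continuous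
from below, and suprema preserve the three properties. The Orlicz form is a change of variable,
since `H_{0,Q}(X) = exp E_Q[log X]`. -/

theorem rv_ext {X Y : LInftyPP P} (h : X.rv =ᵐ[P] Y.rv) : X = Y := Subtype.ext (Lp.ext h)

theorem exists_abs_log_rv_le (X : LInftyPP P) :
    ∃ M : ℝ, ∀ᵐ ω ∂P, |Real.log (X.rv ω)| ≤ M := by
  obtain ⟨a, b, ha, hb, hX⟩ := X.exists_bounds
  refine ⟨max |Real.log a| |Real.log b|, ?_⟩
  filter_upwards [hX] with ω hω
  exact abs_le_max_abs_abs (Real.log_le_log ha hω.1)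
    (Real.log_le_log (ha.trans_le hω.1) hω.2)

theorem aemeasurable_log_rv (X : LInftyPP P) : AEMeasurable (fun ω => Real.log (X.rv ω)) P :=
  Real.measurable_log.comp_aemeasurable X.aestronglyMeasurable.aemeasurable

theorem rv_pos (X : LInftyPP P) : ∀ᵐ ω ∂P, 0 < X.rv ω := by
  obtain ⟨a, b, ha, hb, hX⟩ := X.exists_bounds
  filter_upwards [hX] with ω hω using ha.trans_le hω.1

theorem ACProb.ac (Q : ACProb P) : Q.meas ≪ P := Q.2

theorem integrable_log_rv (Q : ACProb P) (X : LInftyPP P) :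
    Integrable (fun ω => Real.log (X.rv ω)) Q.meas := by
  obtain ⟨M, hM⟩ := exists_abs_log_rv_le X
  exact Integrable.of_bound ((aemeasurable_log_rv X).mono_ac Q.ac).aestronglyMeasurable M
    (Q.ac.ae_le hM)

theorem expLog_mono (Q : ACProb P) {X Y : LInftyPP P} (h : X.rv ≤ᵐ[P] Y.rv) :
    expLog Q X ≤ expLog Q Y := by
  refine integral_mono_ae (integrable_log_rv Q X) (integrable_log_rv Q Y) (Q.ac.ae_le ?_)
  filter_upwards [h, rv_pos X] with ω h1 h2 using Real.log_le_log h2 h1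

theorem log_geomMean_rv [IsFiniteMeasure P] (X Y : LInftyPP P) (α : Set.Ioo (0 : ℝ) 1) :
    (fun ω => Real.log ((geomMean X Y α).rv ω)) =ᵐ[P]
      fun ω => α * Real.log (X.rv ω) + (1 - α) * Real.log (Y.rv ω) := by
  have h : (geomMean X Y α).rv =ᵐ[P] _ := LInftyPP.mk_rv _ _ _
  filter_upwards [h, rv_pos X, rv_pos Y] with ω h hx hy
  rw [h, Real.log_mul (Real.rpow_pos_of_pos hx _).ne' (Real.rpow_pos_of_pos hy _).ne',
    Real.log_rpow hx, Real.log_rpow hy]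

theorem expLog_geomMean [IsFiniteMeasure P] (Q : ACProb P) (X Y : LInftyPP P)
    (α : Set.Ioo (0 : ℝ) 1) :
    expLog Q (geomMean X Y α) = α * expLog Q X + (1 - α) * expLog Q Y := by
  unfold expLog
  rw [integral_congr_ae (Q.ac.ae_le (log_geomMean_rv X Y α)),
    integral_add ((integrable_log_rv Q X).const_mul _) ((integrable_log_rv Q Y).const_mul _),
    integral_const_mul, integral_const_mul]

theorem tendsto_expLog (Q : ACProb P) {X : ℕ → LInftyPP P} {X' : LInftyPP P}
    (h : ∀ᵐ ω ∂P, Monotone (fun n => (X n).rv ω) ∧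
      Tendsto (fun n => (X n).rv ω) atTop (𝓝 (X'.rv ω))) :
    Monotone (fun n => expLog Q (X n)) ∧
      Tendsto (fun n => expLog Q (X n)) atTop (𝓝 (expLog Q X')) := by
  have hm : Monotone (fun n => expLog Q (X n)) := fun m n hmn =>
    expLog_mono Q (by filter_upwards [h] with ω hω using hω.1 hmn)
  refine ⟨hm, integral_tendsto_of_tendsto_of_monotone (fun n => integrable_log_rv Q (X n))
    (integrable_log_rv Q X') (Q.ac.ae_le ?_) (Q.ac.ae_le ?_)⟩
  · filter_upwards [h, ae_all_iff.2 fun n => rv_pos (X n)] with ω hω hp m n hmn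
    exact Real.log_le_log (hp m) (hω.1 hmn)
  · filter_upwards [h, rv_pos X'] with ω hω hp
    exact hω.2.log hp.ne'

/-- Since `E_Q[log (X / k)] = E_Q[log X] - log k`, the admissible `k` form a closed half-line whose
left endpoint is the right-hand side. -/
theorem orliczPremium_eq (Q : ACProb P) (X : LInftyPP P) :
    orliczPremium Q X = Real.exp (expLog Q X) := by
  have : {k : ℝ | 0 < k ∧ ∫ ω, Real.log (X.rv ω / k) ∂Q.meas ≤ 0} =
      Set.Ici (Real.exp (expLog Q X)) := by
    ext k
    simp only [Set.mem_ofPred_eq, Set.mem_Ici]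
    have key : 0 < k → ∫ ω, Real.log (X.rv ω / k) ∂Q.meas = expLog Q X - Real.log k := by
      intro hk
      have : (fun ω => Real.log (X.rv ω / k)) =ᵐ[Q.meas]
          fun ω => Real.log (X.rv ω) - Real.log k := by
        filter_upwards [Q.ac.ae_le (rv_pos X)] with ω hω
        rw [Real.log_div hω.ne' hk.ne']
      rw [integral_congr_ae this, integral_sub (integrable_log_rv Q X) (integrable_const _)]
      simp [expLog]
    constructor
    · rintro ⟨hk, h⟩
      rw [key hk, sub_nonpos] at h
      rwa [← Real.le_log_iff_exp_le hk]
    · intro h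
      have hk : 0 < k := (Real.exp_pos _).trans_le h
      rw [key hk, sub_nonpos, Real.le_log_iff_exp_le hk]
      exact ⟨hk, h⟩
  rw [orliczPremium, this, csInf_Ici]

theorem log_orliczPremiumPos (Q : ACProb P) (X : LInftyPP P) :
    Real.log (orliczPremiumPos Q X : ℝ) = expLog Q X := by
  rw [← Real.log_exp (expLog Q X), ← orliczPremium_eq]
  rfl

theorem representedBy_iff_orliczRepresentedBy (ρ : LInftyPP P → ℝ≥0∞)
    (N : ℝ → ACProb P → EReal) :
    RepresentedBy ρ N ↔
      OrliczRepresentedBy ρ (fun s Q => EReal.exp (N (Real.log (s : ℝ)) Q)) := by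
  simp only [RepresentedBy, OrliczRepresentedBy, log_orliczPremiumPos]

/-- `E_Q[log ·]` of a geometric mean lies between its values at the two factors, so an increasing
function of it is at most the larger of the two values. Continuity from below comes from monotone
convergence and from interchanging the suprema over `n` and `Q`. -/
theorem RepresentedBy.regularity [IsFiniteMeasure P] {ρ : LInftyPP P → ℝ≥0∞}
    {N : ℝ → ACProb P → EReal}
    (hN : ∀ Q, Monotone (fun t => N t Q) ∧ ContFromBelow (fun t => N t Q))
    (h : RepresentedBy ρ N) :
    IsMonotone ρ ∧ IsQuasiLogconvex ρ ∧ IsContinuousFromBelow ρ := by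
  have hexp : Monotone EReal.exp := EReal.expOrderIso.monotone
  have hmono : IsMonotone ρ := by
    intro X Y hXY
    rw [h X, h Y]
    exact iSup_mono fun Q => hexp ((hN Q).1 (expLog_mono Q hXY))
  refine ⟨hmono, ?_, ?_⟩
  · intro X Y α
    rw [h (geomMean X Y α)]
    refine iSup_le fun Q => ?_
    have hX : EReal.exp (N (expLog Q X) Q) ≤ ρ X := by
      rw [h X]; exact le_iSup (fun Q => EReal.exp (N (expLog Q X) Q)) Q
    have hY : EReal.exp (N (expLog Q Y) Q) ≤ ρ Y := by
      rw [h Y]; exact le_iSup (fun Q => EReal.exp (N (expLog Q Y) Q)) Q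
    have h0 := α.2.1
    have h1 := α.2.2
    rw [expLog_geomMean]
    rcases le_total (expLog Q X) (expLog Q Y) with hle | hle
    · refine le_max_of_le_right (le_trans (hexp ((hN Q).1 ?_)) hY)
      nlinarith
    · refine le_max_of_le_left (le_trans (hexp ((hN Q).1 ?_)) hX)
      nlinarith
  · intro X X' hX
    have hm : Monotone fun n => ρ (X n) := fun m n hmn =>
      hmono _ _ (by filter_upwards [hX] with ω hω using hω.1 hmn)
    have hsup : ρ X' = ⨆ n, ρ (X n) := by
      simp only [h _]
      rw [iSup_comm]
      refine iSup_congr fun Q => ?_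
      obtain ⟨h1, h2⟩ := tendsto_expLog Q hX
      refine tendsto_nhds_unique (((ENNReal.continuous_exp.tendsto _).comp ((hN Q).2 _ _ h1 h2)))
        (tendsto_atTop_iSup fun m n hmn => hexp ((hN Q).1 (h1 hmn)))
    rw [hsup]
    exact tendsto_atTop_iSup hm

theorem OrliczRepresentedBy.exists_representedBy {ρ : LInftyPP P → ℝ≥0∞}
    {R : Set.Ioi (0 : ℝ) → ACProb P → ℝ≥0∞}
    (hR : ∀ Q, Monotone (fun s => R s Q) ∧ ContFromBelow (fun s => R s Q))
    (h : OrliczRepresentedBy ρ R) :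
    ∃ N : ℝ → ACProb P → EReal,
      (∀ Q, Monotone (fun t => N t Q) ∧ ContFromBelow (fun t => N t Q)) ∧ RepresentedBy ρ N := by
  let e : ℝ → Set.Ioi (0 : ℝ) := fun t => ⟨Real.exp t, Real.exp_pos t⟩
  have he : Monotone e := fun s t hst => Real.exp_le_exp.2 hst
  have hc : Continuous e := Real.continuous_exp.subtype_mk _
  refine ⟨fun t Q => ENNReal.log (R (e t) Q), fun Q => ⟨fun s t hst => ?_, ?_⟩, ?_⟩
  · exact ENNReal.logOrderIso.monotone ((hR Q).1 (he hst))
  · intro u t hu hut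
    exact (ENNReal.continuous_log.tendsto _).comp
      ((hR Q).2 (e ∘ u) (e t) (he.comp hu) ((hc.tendsto t).comp hut))
  · intro X
    rw [h X]
    refine iSup_congr fun Q => ?_
    rw [ENNReal.exp_log]
    congr
    exact Subtype.ext (orliczPremium_eq Q X)

theorem RepresentedBy.exists_orliczRepresentedBy {ρ : LInftyPP P → ℝ≥0∞}
    {N : ℝ → ACProb P → EReal}
    (hN : ∀ Q, Monotone (fun t => N t Q) ∧ ContFromBelow (fun t => N t Q))
    (h : RepresentedBy ρ N) :
    ∃ R : Set.Ioi (0 : ℝ) → ACProb P → ℝ≥0∞,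
      (∀ Q, Monotone (fun s => R s Q) ∧ ContFromBelow (fun s => R s Q)) ∧
        OrliczRepresentedBy ρ R := by
  have hl : Monotone fun s : Set.Ioi (0 : ℝ) => Real.log s := fun s t hst =>
    Real.log_le_log s.2 hst
  refine ⟨fun s Q => EReal.exp (N (Real.log (s : ℝ)) Q), fun Q => ⟨fun s t hst => ?_, ?_⟩,
    (representedBy_iff_orliczRepresentedBy ρ N).1 h⟩
  · exact EReal.expOrderIso.monotone ((hN Q).1 (hl hst))
  · intro u t hu hut
    exact (ENNReal.continuous_exp.tendsto _).comp ((hN Q).2 _ _ (hl.comp hu)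
      (((continuous_subtype_val.tendsto t).comp hut).log (ne_of_gt t.2)))

theorem dualFn_mono (ρ : LInftyPP P → ℝ≥0∞) (Q : ACProb P) :
    Monotone (fun t => dualFn ρ t Q) := fun _ _ hst =>
  iInf_mono fun _ => iInf_mono' fun h => ⟨hst.trans h, le_rfl⟩

theorem leftReg_mono (N : ℝ → ACProb P → EReal) (Q : ACProb P) :
    Monotone (fun t => leftReg N t Q) := fun _ _ hst =>
  iSup_mono fun _ => iSup_mono' fun h => ⟨h.trans_le hst, le_rfl⟩

/-- Every `s < t` is eventually exceeded by a sequence tending to `t`, so no term of the supremum is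
lost in the limit. -/
theorem leftReg_contFromBelow (N : ℝ → ACProb P → EReal) (Q : ACProb P) :
    ContFromBelow (fun t => leftReg N t Q) := by
  intro u t hu hut
  have : leftReg N t Q = ⨆ n, leftReg N (u n) Q := by
    refine le_antisymm (iSup₂_le fun s hs => ?_)
      (iSup_le fun n => leftReg_mono N Q (hu.ge_of_tendsto hut n))
    obtain ⟨n, hn⟩ := (hut.eventually_const_lt hs).exists
    exact le_iSup_of_le n (le_iSup₂_of_le s hn le_rfl)
  simp only [this]
  exact tendsto_atTop_iSup ((leftReg_mono N Q).comp hu)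

theorem exp_dualFn_le (ρ : LInftyPP P → ℝ≥0∞) (X : LInftyPP P) (Q : ACProb P) :
    EReal.exp (dualFn ρ (expLog Q X) Q) ≤ ρ X := by
  rw [← ENNReal.exp_log (ρ X)]
  exact EReal.expOrderIso.monotone (iInf_le_of_le X (iInf_le_of_le le_rfl le_rfl))

theorem leftReg_dualFn_le (ρ : LInftyPP P → ℝ≥0∞) (t : ℝ) (Q : ACProb P) :
    leftReg (dualFn ρ) t Q ≤ dualFn ρ t Q :=
  iSup₂_le fun _ hs => dualFn_mono ρ Q hs.le

end QuasiLogconvex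

/-! ### Nested convex sets in a Hilbert space. -/

/-- A decreasing sequence of nonempty, bounded, closed, convex subsets of a Hilbert space has
nonempty intersection. -/
theorem Antitone.nonempty_iInter_of_convex_closed_bounded {H : Type*} [NormedAddCommGroup H]
    [InnerProductSpace ℝ H] [CompleteSpace H] {K : ℕ → Set H} (hK : Antitone K)
    (hne : ∀ n, (K n).Nonempty) (hconv : ∀ n, Convex ℝ (K n)) (hcl : ∀ n, IsClosed (K n))
    {M : ℝ} (hM : ∀ n, ∀ x ∈ K n, ‖x‖ ≤ M) : (⋂ n, K n).Nonempty := by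
  have hmin : ∀ n, ∃ x ∈ K n, ∀ y ∈ K n, ‖x‖ ≤ ‖y‖ := by
    intro n
    obtain ⟨x, hx, hx'⟩ := exists_norm_eq_iInf_of_complete_convex (hne n) (hcl n).isComplete
      (hconv n) 0
    refine ⟨x, hx, fun y hy => ?_⟩
    simp only [zero_sub, norm_neg] at hx'
    rw [hx']
    exact ciInf_le ⟨0, by rintro _ ⟨w, rfl⟩; exact norm_nonneg _⟩ (⟨y, hy⟩ : K n)
  choose x hx hxmin using hmin
  have hmono : Monotone fun n => ‖x n‖ ^ 2 := fun m n hmn =>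
    pow_le_pow_left₀ (norm_nonneg _) (hxmin m _ (hK hmn (hx n))) 2
  have hbdd : BddAbove (Set.range fun n => ‖x n‖ ^ 2) :=
    ⟨M ^ 2, by rintro _ ⟨n, rfl⟩; exact pow_le_pow_left₀ (norm_nonneg _) (hM n _ (hx n)) 2⟩
  have hlim := tendsto_atTop_ciSup hmono hbdd
  set d := ⨆ n, ‖x n‖ ^ 2
  -- The midpoint of `x n` and `x m` lies in `K m`, so its norm is at least `‖x m‖`. The
  -- parallelogram law then bounds the distance by the growth of the minimal norms, which converge;
  -- the minimizers are therefore Cauchy.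
  have hkey : ∀ m n, m ≤ n → ‖x n - x m‖ ^ 2 ≤ 2 * (d - ‖x m‖ ^ 2) := by
    intro m n hmn
    have hmid : (1 / 2 : ℝ) • x n + (1 / 2 : ℝ) • x m ∈ K m :=
      hconv m (hK hmn (hx n)) (hx m) (by norm_num) (by norm_num) (by norm_num)
    have h1 := hxmin m _ hmid
    rw [← smul_add, norm_smul, Real.norm_of_nonneg (by norm_num)] at h1
    have h2 := parallelogram_law_with_norm ℝ (x n) (x m)
    have h3 : ‖x n‖ ^ 2 ≤ d := le_ciSup hbdd n
    nlinarith [norm_nonneg (x m), norm_nonneg (x n + x m)]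
  have hcauchy : CauchySeq x := by
    rw [Metric.cauchySeq_iff']
    intro ε hε
    have : ∀ᶠ m in atTop, d - ε ^ 2 / 4 < ‖x m‖ ^ 2 :=
      hlim.eventually_const_lt (by linarith [pow_pos hε 2])
    obtain ⟨m, hm⟩ := this.exists
    refine ⟨m, fun n hn => ?_⟩
    rw [dist_eq_norm]
    have := hkey m n hn
    exact lt_of_pow_lt_pow_left₀ 2 hε.le (by linarith [pow_pos hε 2])
  obtain ⟨y, hy⟩ := cauchySeq_tendsto_of_complete hcauchy
  refine ⟨y, Set.mem_iInter.2 fun n => (hcl n).mem_of_tendsto hy ?_⟩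
  filter_upwards [eventually_ge_atTop n] with m hm using hK hm (hx m)

/-! ### Weak compactness in `L^∞`, obtained through `L²`. -/

namespace QuasiLogconvex

variable {Ω : Type*} [MeasurableSpace Ω] {P : Measure Ω}

theorem ae_abs_le_norm (u : Lp ℝ ∞ P) : ∀ᵐ ω ∂P, |u ω| ≤ ‖u‖ := by
  filter_upwards [ae_le_eLpNormEssSup (f := u) (μ := P)] with ω h
  have hfin : eLpNormEssSup u P ≠ ∞ := by
    have := Lp.eLpNorm_ne_top u
    rwa [eLpNorm_exponent_top] at this
  rw [Lp.norm_def, eLpNorm_exponent_top]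
  simpa using ENNReal.toReal_mono hfin h

/-- A set of essentially bounded functions that contains the almost sure limits of its uniformly
bounded sequences. -/
def IsBddAEClosed (C : Set (Lp ℝ ∞ P)) : Prop :=
  ∀ (M : ℝ) (u : ℕ → Lp ℝ ∞ P) (v : Lp ℝ ∞ P), (∀ n, ∀ᵐ ω ∂P, |u n ω| ≤ M) →
    (∀ᵐ ω ∂P, Tendsto (fun n => u n ω) atTop (𝓝 (v ω))) → (∀ n, u n ∈ C) → v ∈ C

theorem IsBddAEClosed.inter {C D : Set (Lp ℝ ∞ P)} (hC : IsBddAEClosed C)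
    (hD : IsBddAEClosed D) : IsBddAEClosed (C ∩ D) := fun M u v hM hv hu =>
  ⟨hC M u v hM hv fun n => (hu n).1, hD M u v hM hv fun n => (hu n).2⟩

/-- The functions with values almost surely in `[a, b]`. -/
def orderBox (P : Measure Ω) (a b : ℝ) : Set (Lp ℝ ∞ P) := {u | ∀ᵐ ω ∂P, a ≤ u ω ∧ u ω ≤ b}

theorem convex_orderBox (a b : ℝ) : Convex ℝ (orderBox P a b) := by
  intro u hu v hv s t hs ht hst
  have hu : ∀ᵐ ω ∂P, a ≤ u ω ∧ u ω ≤ b := hu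
  have hv : ∀ᵐ ω ∂P, a ≤ v ω ∧ v ω ≤ b := hv
  show ∀ᵐ ω ∂P, _
  filter_upwards [hu, hv, Lp.coeFn_add (s • u) (t • v), Lp.coeFn_smul s u, Lp.coeFn_smul t v]
    with ω h1 h2 h3 h4 h5
  simp only [Pi.add_apply, Pi.smul_apply, smul_eq_mul] at h3 h4 h5
  rw [h3, h4, h5]
  obtain rfl : t = 1 - s := by linarith
  constructor <;> nlinarith

theorem isBddAEClosed_orderBox (a b : ℝ) : IsBddAEClosed (orderBox P a b) := by
  intro M u v _ hv hu
  have hu : ∀ᵐ ω ∂P, ∀ n, a ≤ u n ω ∧ u n ω ≤ b := ae_all_iff.2 hu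
  show ∀ᵐ ω ∂P, _
  filter_upwards [hv, hu] with ω h1 h2
  exact ⟨ge_of_tendsto' h1 fun n => (h2 n).1, le_of_tendsto' h1 fun n => (h2 n).2⟩

variable [IsProbabilityMeasure P]

/-- The functions whose expected excess over the level `a` is at most `δ`. -/
def excessLE (P : Measure Ω) (a δ : ℝ) : Set (Lp ℝ ∞ P) := {u | ∫ ω, max (u ω - a) 0 ∂P ≤ δ}

theorem integrable_excess (u : Lp ℝ ∞ P) (a : ℝ) : Integrable (fun ω => max (u ω - a) 0) P := by
  have : Integrable u P := (Lp.memLp u).integrable (by simp)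
  exact (this.sub (integrable_const a)).pos_part

theorem convex_excessLE (a δ : ℝ) : Convex ℝ (excessLE P a δ) := by
  intro u hu v hv s t hs ht hst
  have hu : ∫ ω, max (u ω - a) 0 ∂P ≤ δ := hu
  have hv : ∫ ω, max (v ω - a) 0 ∂P ≤ δ := hv
  show ∫ ω, max ((s • u + t • v : Lp ℝ ∞ P) ω - a) 0 ∂P ≤ δ
  calc _ ≤ ∫ ω, (s * max (u ω - a) 0 + t * max (v ω - a) 0) ∂P := by
        refine integral_mono_ae (integrable_excess _ _)
          (((integrable_excess u a).const_mul s).add ((integrable_excess v a).const_mul t)) ?_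
        filter_upwards [Lp.coeFn_add (s • u) (t • v), Lp.coeFn_smul s u, Lp.coeFn_smul t v]
          with ω h3 h4 h5
        simp only [Pi.add_apply, Pi.smul_apply, smul_eq_mul] at h3 h4 h5 ⊢
        rw [h3, h4, h5]
        obtain rfl : t = 1 - s := by linarith
        have h1 := mul_le_mul_of_nonneg_left (le_max_left (u ω - a) 0) hs
        have h2 := mul_le_mul_of_nonneg_left (le_max_left (v ω - a) 0) ht
        have h6 := mul_nonneg hs (le_max_right (u ω - a) 0)
        have h7 := mul_nonneg ht (le_max_right (v ω - a) 0)
        exact max_le (by linarith) (by linarith)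
    _ = s * ∫ ω, max (u ω - a) 0 ∂P + t * ∫ ω, max (v ω - a) 0 ∂P := by
        rw [integral_add ((integrable_excess u a).const_mul s)
          ((integrable_excess v a).const_mul t), integral_const_mul, integral_const_mul]
    _ ≤ δ := by
        obtain rfl : t = 1 - s := by linarith
        nlinarith

theorem isBddAEClosed_excessLE (a δ : ℝ) : IsBddAEClosed (excessLE P a δ) := by
  intro M u v hM hv hu
  refine le_of_tendsto' (tendsto_integral_of_dominated_convergence (fun _ => M + |a|)
    (fun n => (integrable_excess (u n) a).1) (integrable_const _) (fun n => ?_) ?_) hu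
  · filter_upwards [hM n] with ω h
    rw [Real.norm_eq_abs, abs_of_nonneg (le_max_right _ _)]
    have := abs_le.1 h
    have := neg_abs_le a
    exact max_le (by linarith) (by linarith [(abs_nonneg (u n ω)), abs_nonneg a])
  · filter_upwards [hv] with ω h
    exact (h.sub_const a).max tendsto_const_nhds

/-- Weak compactness, in the form of a finite intersection property, of the uniformly bounded
convex sets that are closed under bounded almost sure convergence. -/
theorem nonempty_iInter_of_convex_isBddAEClosed {C : ℕ → Set (Lp ℝ ∞ P)} (hC : Antitone C)
    (hne : ∀ n, (C n).Nonempty) (hconv : ∀ n, Convex ℝ (C n)) (hcl : ∀ n, IsBddAEClosed (C n))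
    {M : ℝ} (hM : ∀ n, ∀ u ∈ C n, ∀ᵐ ω ∂P, |u ω| ≤ M) : (⋂ n, C n).Nonempty := by
  -- The same sets viewed in `L²`. They are norm closed there: an `L²`-convergent sequence has an
  -- a.s. convergent subsequence, and the uniform bound `M` makes `IsBddAEClosed` applicable.
  let K : ℕ → Set (Lp ℝ 2 P) := fun n => {w | ∃ u ∈ C n, u =ᵐ[P] w}
  have h2 : ∀ u : Lp ℝ ∞ P, MemLp u 2 P := fun u => (Lp.memLp u).mono_exponent le_top
  have hM0 : 0 ≤ M := by
    obtain ⟨u, hu⟩ := hne 0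
    obtain ⟨ω, hω⟩ := (hM 0 u hu).exists
    exact (abs_nonneg _).trans hω
  have hKcl : ∀ n, IsClosed (K n) := by
    intro n
    refine IsSeqClosed.isClosed fun w w' hw hlim => ?_
    choose u hu huw using hw
    obtain ⟨ns, -, hns⟩ := (tendstoInMeasure_of_tendsto_Lp hlim).exists_seq_tendsto_ae
    have hb : ∀ᵐ ω ∂P, ∀ k, |u k ω| ≤ M := ae_all_iff.2 fun k => hM n _ (hu k)
    have hlim' : ∀ᵐ ω ∂P, Tendsto (fun i => u (ns i) ω) atTop (𝓝 (w' ω)) := by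
      filter_upwards [hns, ae_all_iff.2 huw] with ω h1 h2
      simpa only [h2] using h1
    have hw' : MemLp w' ∞ P := by
      refine memLp_top_of_bound (Lp.aestronglyMeasurable w') M ?_
      filter_upwards [hb, hlim'] with ω h1 h2
      exact le_of_tendsto' h2.norm fun k => h1 _
    refine ⟨hw'.toLp w', hcl n M (fun i => u (ns i)) _ (fun i => hM n _ (hu _)) ?_
      (fun i => hu _), hw'.coeFn_toLp⟩
    filter_upwards [hlim', hw'.coeFn_toLp] with ω h1 h2
    rwa [h2]
  have hKne : ∀ n, (K n).Nonempty := fun n => by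
    obtain ⟨u, hu⟩ := hne n
    exact ⟨(h2 u).toLp u, u, hu, (h2 u).coeFn_toLp.symm⟩
  have hKconv : ∀ n, Convex ℝ (K n) := by
    rintro n w ⟨u, hu, huw⟩ w' ⟨u', hu', huw'⟩ s t hs ht hst
    refine ⟨s • u + t • u', hconv n hu hu' hs ht hst, ?_⟩
    filter_upwards [huw, huw', Lp.coeFn_add (s • u) (t • u'), Lp.coeFn_smul s u,
      Lp.coeFn_smul t u', Lp.coeFn_add (s • w) (t • w'), Lp.coeFn_smul s w,
      Lp.coeFn_smul t w'] with ω e1 e2 e3 e4 e5 e6 e7 e8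
    simp only [Pi.add_apply, Pi.smul_apply] at e3 e4 e5 e6 e7 e8
    rw [e3, e4, e5, e6, e7, e8, e1, e2]
  have hKM : ∀ n, ∀ w ∈ K n, ‖w‖ ≤ M := by
    rintro n w ⟨u, hu, huw⟩
    have := Lp.norm_le_of_ae_bound (f := w) hM0 (by
      filter_upwards [huw, hM n u hu] with ω h1 h2
      rwa [← h1])
    simpa [measureUnivNNReal] using this
  obtain ⟨w, hw⟩ := Antitone.nonempty_iInter_of_convex_closed_bounded (K := K)
    (fun m n hmn w ⟨u, hu, huw⟩ => ⟨u, hC hmn hu, huw⟩) hKne hKconv hKcl hKM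
  rw [Set.mem_iInter] at hw
  obtain ⟨u, hu, huw⟩ := hw 0
  refine ⟨u, Set.mem_iInter.2 fun n => ?_⟩
  -- The witnesses for different `n` all represent `w`, so they coincide.
  obtain ⟨u', hu', huw'⟩ := hw n
  rwa [show u = u' from Lp.ext (huw.trans huw'.symm)]

end QuasiLogconvex

/-! ### Separation by a functional bounded on a neighbourhood of `0`. -/

namespace QuasiLogconvex

variable {Ω : Type*} [MeasurableSpace Ω] {P : Measure Ω}

/-- The functions whose expected excess over each level `n` is at most `δ n`. -/
def excessSet (P : Measure Ω) (δ : ℕ → ℝ) : Set (Lp ℝ ∞ P) := ⋂ n : ℕ, excessLE P n (δ n)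

/-- `excessSet` contains all nonpositive functions. If `f u < 0`, the nonpositive multiple `(2c / f
u) • u` would have value `2c > c`. -/
theorem nonneg_of_le_on_excessSet {δ : ℕ → ℝ} (hδ : ∀ n, 0 < δ n) {f : Lp ℝ ∞ P →L[ℝ] ℝ}
    {c : ℝ} (hc : 0 < c) (hf : ∀ u ∈ excessSet P δ, f u ≤ c) {u : Lp ℝ ∞ P} (hu : 0 ≤ u) :
    0 ≤ f u := by
  by_contra! hneg
  have hmem : (2 * c / f u) • u ∈ excessSet P δ := by
    refine Set.mem_iInter.2 fun n => ?_
    have : (fun ω => max (((2 * c / f u) • u : Lp ℝ ∞ P) ω - n) 0) =ᵐ[P] 0 := by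
      filter_upwards [Lp.coeFn_smul (2 * c / f u) u, (Lp.coeFn_nonneg u).2 hu] with ω h1 h2
      rw [h1]
      simp only [Pi.zero_apply, Pi.smul_apply, smul_eq_mul] at h2 ⊢
      refine max_eq_right ?_
      have := mul_nonpos_of_nonpos_of_nonneg
        (div_nonpos_of_nonneg_of_nonpos (by linarith : 0 ≤ 2 * c) hneg.le) h2
      linarith [(n.cast_nonneg : (0 : ℝ) ≤ n)]
    show ∫ ω, _ ∂P ≤ δ n
    rw [integral_congr_ae this]
    simpa using (hδ n).le
  have := hf _ hmem
  rw [map_smul, smul_eq_mul, div_mul_cancel₀ _ hneg.ne] at this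
  linarith

variable [IsProbabilityMeasure P]

/-- The bounds force the expected excess over `n` to vanish, so `u ≤ n` a.s. -/
theorem orderBox_succ_inter_excessLE_zero (n : ℕ) {u : Lp ℝ ∞ P}
    (hu : u ∈ orderBox P 0 (n + 1)) (h : ∀ j : ℕ, u ∈ excessLE P n (1 / ((j : ℝ) + 1))) :
    u ∈ orderBox P 0 n := by
  have hu : ∀ᵐ ω ∂P, 0 ≤ u ω ∧ u ω ≤ n + 1 := hu
  have h0 : ∫ ω, max (u ω - n) 0 ∂P ≤ 0 :=
    ge_of_tendsto' tendsto_one_div_add_atTop_nhds_zero_nat h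
  have h1 : (fun ω => max (u ω - n) 0) =ᵐ[P] 0 :=
    (integral_eq_zero_iff_of_nonneg (fun ω => le_max_right _ _) (integrable_excess u n)).1
      (le_antisymm h0 (integral_nonneg fun ω => le_max_right _ _))
  show ∀ᵐ ω ∂P, _
  filter_upwards [hu, h1] with ω h2 h3
  exact ⟨h2.1, by have := le_max_left (u ω - n) 0; simp only [Pi.zero_apply] at h3; linarith⟩

/-- If no `ε` worked, the sets for `ε = 1 / (j + 1)` would be nested, bounded and nonempty. By
compactness they would share a point, which has no excess over `n` and so lies in the intersection
assumed empty. -/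
theorem exists_excess_bound_step {D : Set (Lp ℝ ∞ P)} (hconv : Convex ℝ D)
    (hcl : IsBddAEClosed D) (n : ℕ) {T : Set (Lp ℝ ∞ P)} (hTconv : Convex ℝ T)
    (hTcl : IsBddAEClosed T) (h : D ∩ T ∩ orderBox P 0 n = ∅) :
    ∃ ε > 0, D ∩ (T ∩ excessLE P n ε) ∩ orderBox P 0 (n + 1) = ∅ := by
  by_contra! hcon
  let C : ℕ → Set (Lp ℝ ∞ P) := fun j =>
    D ∩ (T ∩ excessLE P n (1 / ((j : ℝ) + 1))) ∩ orderBox P 0 (n + 1)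
  have hanti : Antitone C := by
    rintro i j hij u ⟨⟨h1, h2, h3⟩, h4⟩
    have hij' : (i : ℝ) ≤ j := by exact_mod_cast hij
    have hle : 1 / ((j : ℝ) + 1) ≤ 1 / ((i : ℝ) + 1) :=
      one_div_le_one_div_of_le (by positivity) (by linarith)
    exact ⟨⟨h1, h2, le_trans (show ∫ ω, max (u ω - n) 0 ∂P ≤ 1 / ((j : ℝ) + 1) from h3) hle⟩, h4⟩
  obtain ⟨u, hu⟩ := nonempty_iInter_of_convex_isBddAEClosed (M := n + 1) hanti
    (fun j => hcon _ (by positivity))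
    (fun j => (hconv.inter (hTconv.inter (convex_excessLE _ _))).inter (convex_orderBox _ _))
    (fun j => (hcl.inter (hTcl.inter (isBddAEClosed_excessLE _ _))).inter
      (isBddAEClosed_orderBox _ _))
    (fun j u hu => by
      have : ∀ᵐ ω ∂P, 0 ≤ u ω ∧ u ω ≤ n + 1 := hu.2
      filter_upwards [this] with ω hω
      rw [abs_of_nonneg hω.1]; exact hω.2)
  rw [Set.mem_iInter] at hu
  have : u ∈ D ∩ T ∩ orderBox P 0 n := ⟨⟨(hu 0).1.1, (hu 0).1.2.1⟩,
    orderBox_succ_inter_excessLE_zero n (hu 0).2 fun j => (hu j).1.2.2⟩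
  rw [h] at this
  exact this

theorem convex_excessSet (δ : ℕ → ℝ) : Convex ℝ (excessSet P δ) :=
  convex_iInter fun _ => convex_excessLE _ _

/-- The Krein–Šmulian construction: the thresholds are chosen inductively so that, after those below
level `n` are imposed, no element of `D` with values in `[0, n]` survives. Every bounded function
falls under some `n`. -/
theorem exists_disjoint_excessSet {D : Set (Lp ℝ ∞ P)} (hconv : Convex ℝ D)
    (hup : IsUpperSet D) (hcl : IsBddAEClosed D) (h0 : 0 ∉ D) :
    ∃ δ : ℕ → ℝ, (∀ n, 0 < δ n) ∧ Disjoint (excessSet P δ) D := by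
  let S : ℕ → Type _ := fun n => {T : Set (Lp ℝ ∞ P) //
    Convex ℝ T ∧ IsBddAEClosed T ∧ D ∩ T ∩ orderBox P 0 n = ∅}
  have hstep : ∀ (n : ℕ) (T : S n), ∃ ε > 0, D ∩ (T.1 ∩ excessLE P n ε) ∩
      orderBox P 0 (n + 1) = ∅ := fun n T =>
    exists_excess_bound_step hconv hcl n T.2.1 T.2.2.1 T.2.2.2
  choose ε hε hεD using hstep
  -- The induction starts because the box `[0, 0]` contains only `0`, which `D` misses.
  let T0 : S 0 := ⟨Set.univ, convex_univ, fun _ _ _ _ _ _ => Set.mem_univ _, by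
    rw [Set.inter_univ, Set.eq_empty_iff_forall_notMem]
    rintro u ⟨hu, hb⟩
    have hb : ∀ᵐ ω ∂P, 0 ≤ u ω ∧ u ω ≤ (0 : ℕ) := hb
    refine h0 ((Lp.ext ?_ : u = 0) ▸ hu)
    filter_upwards [hb, Lp.coeFn_zero ℝ ∞ P] with ω h1 h2
    rw [h2]
    exact le_antisymm (by simpa using h1.2) h1.1⟩
  let T : ∀ n, S n := fun n => Nat.rec T0 (fun n T => ⟨T.1 ∩ excessLE P n (ε n T),
    T.2.1.inter (convex_excessLE _ _), T.2.2.1.inter (isBddAEClosed_excessLE _ _), by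
      simpa using hεD n T⟩) n
  have hsub : ∀ n, excessSet P (fun n => ε n (T n)) ⊆ (T n).1 := by
    intro n
    induction n with
    | zero => exact Set.subset_univ _
    | succ n ih => exact Set.subset_inter ih (Set.iInter_subset _ n)
  refine ⟨fun n => ε n (T n), fun n => hε _ _, Set.disjoint_left.2 fun u hu huD => ?_⟩
  obtain ⟨n, hn⟩ := exists_nat_ge ‖u‖
  -- Passing to the positive part puts the function into the box `[0, n]`. It stays in `D`, which is
  -- upward closed, and its excesses do not change because all levels are nonnegative.
  have hpos : (u ⊔ 0 : Lp ℝ ∞ P) =ᵐ[P] fun ω => max (u ω) 0 := by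
    filter_upwards [Lp.coeFn_sup u 0, Lp.coeFn_zero ℝ ∞ P] with ω h1 h2
    rw [h1, Pi.sup_apply, h2]
    rfl
  have hu' : u ⊔ 0 ∈ excessSet P (fun n => ε n (T n)) := by
    refine Set.mem_iInter.2 fun k => ?_
    have huk : ∫ ω, max (u ω - k) 0 ∂P ≤ ε k (T k) := Set.mem_iInter.1 hu k
    refine le_trans (le_of_eq (integral_congr_ae ?_)) huk
    filter_upwards [hpos] with ω h1
    rw [h1]
    have : (0 : ℝ) ≤ k := k.cast_nonneg
    rcases le_total (u ω) 0 with h | h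
    · rw [max_eq_right h, max_eq_right (by linarith), max_eq_right (by linarith)]
    · rw [max_eq_left h]
  have : u ⊔ 0 ∈ D ∩ (T n).1 ∩ orderBox P 0 n := by
    refine ⟨⟨hup le_sup_left huD, hsub n hu'⟩, ?_⟩
    show ∀ᵐ ω ∂P, _
    filter_upwards [hpos, ae_abs_le_norm u] with ω h1 h2
    rw [h1]
    exact ⟨le_max_right _ _, max_le (((le_abs_self _).trans h2).trans hn) n.cast_nonneg⟩
  rw [(T n).2.2.2] at this
  exact this

theorem zero_mem_interior_excessSet {δ : ℕ → ℝ} (hδ : ∀ n, 0 < δ n) :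
    (0 : Lp ℝ ∞ P) ∈ interior (excessSet P δ) := by
  rw [mem_interior_iff_mem_nhds, Metric.mem_nhds_iff]
  -- The bound `1` rules out any excess over the levels `n ≥ 1`; the bound `δ 0` handles level `0`.
  refine ⟨min (δ 0) 1, lt_min (hδ 0) one_pos, fun u hu => Set.mem_iInter.2 fun n => ?_⟩
  rw [mem_ball_zero_iff] at hu
  have hu1 := hu.le.trans (min_le_left _ _)
  have hu2 := hu.le.trans (min_le_right _ _)
  have key : ∀ c : ℝ, 0 ≤ c → (∀ᵐ ω ∂P, u ω - n ≤ c) →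
      ∫ ω, max (u ω - n) 0 ∂P ≤ c := by
    intro c hc h
    have := integral_mono_ae (integrable_excess u n) (integrable_const c) (by
      filter_upwards [h] with ω hω using max_le hω hc)
    simpa using this
  show ∫ ω, max (u ω - n) 0 ∂P ≤ δ n
  rcases n with _ | n
  · refine key _ (hδ 0).le ?_
    filter_upwards [ae_abs_le_norm u] with ω h
    simpa using (le_abs_self _).trans (h.trans hu1)
  · refine (key 0 le_rfl ?_).trans (hδ _).le
    filter_upwards [ae_abs_le_norm u] with ω h
    have := (le_abs_self _).trans (h.trans hu2)
    push_cast
    linarith [(n.cast_nonneg : (0 : ℝ) ≤ n)]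

theorem exists_separating_functional {D : Set (Lp ℝ ∞ P)} (hconv : Convex ℝ D)
    {δ : ℕ → ℝ} (hδ : ∀ n, 0 < δ n) (hdisj : Disjoint (excessSet P δ) D) :
    ∃ (f : Lp ℝ ∞ P →L[ℝ] ℝ) (c : ℝ), 0 < c ∧ (∀ u ∈ excessSet P δ, f u ≤ c) ∧
      ∀ u ∈ D, c ≤ f u := by
  have hV := convex_excessSet (P := P) δ
  have h0 := zero_mem_interior_excessSet (P := P) hδ
  obtain ⟨f, c, hf, hfD⟩ := geometric_hahn_banach_open hV.interior isOpen_interior hconv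
    (hdisj.mono_left interior_subset)
  refine ⟨f, c, by simpa using hf 0 h0, fun u hu => ?_, hfD⟩
  -- Hahn–Banach bounds `f` only on the interior. For `t < 1` the point `t • u` is interior, as `0`
  -- is, and `t → 1` gives the bound at `u`.
  have hlim : Tendsto (fun t : ℝ => f (t • u)) (𝓝[<] 1) (𝓝 (f ((1 : ℝ) • u))) :=
    ((f.continuous.comp (continuous_id.smul continuous_const)).tendsto 1).mono_left
      nhdsWithin_le_nhds
  rw [one_smul] at hlim
  refine le_of_tendsto hlim ?_
  filter_upwards [Ioo_mem_nhdsLT (zero_lt_one' ℝ)] with t ht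
  refine (hf _ (hV.openSegment_interior_self_subset_interior h0 hu
    ⟨1 - t, t, by linarith [ht.2], ht.1, by ring, by simp⟩)).le

/-- The indicator function of a measurable set as an element of `L^∞`. -/
noncomputable def indicatorLp (P : Measure Ω) [IsProbabilityMeasure P] {B : Set Ω}
    (hB : MeasurableSet B) : Lp ℝ ∞ P :=
  indicatorConstLp ∞ hB (measure_ne_top P B) 1

theorem indicatorLp_coeFn {B : Set Ω} (hB : MeasurableSet B) :
    indicatorLp P hB =ᵐ[P] B.indicator fun _ => (1 : ℝ) :=
  indicatorConstLp_coeFn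

theorem indicatorLp_nonneg {B : Set Ω} (hB : MeasurableSet B) : 0 ≤ indicatorLp P hB := by
  rw [← Lp.coeFn_nonneg]
  filter_upwards [indicatorLp_coeFn (P := P) hB] with ω h
  rw [h]
  exact Set.indicator_nonneg (fun _ _ => zero_le_one) ω

/-- It suffices that `(c / ε) • 1_B` lie in `excessSet`, for then `(c / ε) * f 1_B ≤ c`. This
multiple has no excess over levels above `c / ε`, so only finitely many constraints remain, and
small `P B` meets them all. -/
theorem indicatorLp_small_of_le_on_excessSet {δ : ℕ → ℝ} (hδ : ∀ n, 0 < δ n)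
    {f : Lp ℝ ∞ P →L[ℝ] ℝ} {c : ℝ} (hc : 0 < c) (hf : ∀ u ∈ excessSet P δ, f u ≤ c)
    {ε : ℝ} (hε : 0 < ε) :
    ∃ η > 0, ∀ (B : Set Ω) (hB : MeasurableSet B), P.real B < η → f (indicatorLp P hB) ≤ ε := by
  obtain ⟨N, hN⟩ := exists_nat_ge (c / ε)
  obtain ⟨m, hm0, hm⟩ : ∃ m > 0, ∀ n ∈ Finset.range (N + 1), m ≤ δ n := by
    obtain ⟨k, -, hk⟩ := Finset.exists_min_image (Finset.range (N + 1)) δ ⟨0, by simp⟩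
    exact ⟨δ k, hδ k, hk⟩
  have hcε : 0 < c / ε := div_pos hc hε
  refine ⟨m / (c / ε), div_pos hm0 hcε, fun B hB hPB => ?_⟩
  have hmem : (c / ε) • indicatorLp P hB ∈ excessSet P δ := by
    refine Set.mem_iInter.2 fun n => ?_
    have hle : ∫ ω, max (((c / ε) • indicatorLp P hB : Lp ℝ ∞ P) ω - n) 0 ∂P ≤
        ∫ ω, B.indicator (fun _ => max (c / ε - n) 0) ω ∂P := by
      refine integral_mono_ae (integrable_excess _ _) ((integrable_const _).indicator hB) ?_
      filter_upwards [Lp.coeFn_smul (c / ε) (indicatorLp P hB), indicatorLp_coeFn (P := P) hB]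
        with ω h1 h2
      rw [h1, Pi.smul_apply, h2]
      by_cases hω : ω ∈ B <;> simp [hω]
    rw [integral_indicator_const _ hB, smul_eq_mul] at hle
    refine hle.trans ?_
    rcases lt_or_ge n (N + 1) with hn | hn
    · have h1 : max (c / ε - n) 0 ≤ c / ε :=
        max_le (by linarith [(n.cast_nonneg : (0 : ℝ) ≤ n)]) hcε.le
      have h2 : P.real B * (c / ε) < m := (lt_div_iff₀ hcε).1 hPB
      exact ((mul_le_mul_of_nonneg_left h1 measureReal_nonneg).trans h2.le).trans
        (hm n (Finset.mem_range.2 hn))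
    · have : (N : ℝ) + 1 ≤ n := by exact_mod_cast hn
      rw [max_eq_right (by linarith), mul_zero]
      exact (hδ n).le
  have := hf _ hmem
  rw [map_smul, smul_eq_mul, div_mul_eq_mul_div, div_le_iff₀ hε] at this
  exact le_of_mul_le_mul_left this hc

end QuasiLogconvex

/-! ### From functionals on `L^∞` to measures. -/

namespace QuasiLogconvex

variable {Ω : Type*} [MeasurableSpace Ω] {P : Measure Ω}

theorem integrable_of_ac {μ : Measure Ω} [IsFiniteMeasure μ] (hμ : μ ≪ P) (u : Lp ℝ ∞ P) :
    Integrable u μ :=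
  Integrable.of_bound ((Lp.aestronglyMeasurable u).mono_ac hμ) ‖u‖ (hμ.ae_le (ae_abs_le_norm u))

variable [IsProbabilityMeasure P]

theorem indicatorLp_eq_zero {B : Set Ω} (hB : MeasurableSet B) (h : P B = 0) :
    indicatorLp P hB = 0 := by
  refine Lp.ext ?_
  filter_upwards [indicatorLp_coeFn (P := P) hB, Lp.coeFn_zero ℝ ∞ P,
    compl_mem_ae_iff.2 h] with ω h1 h2 h3
  rw [h1, h2, Set.indicator_of_notMem h3]
  rfl

theorem indicatorLp_union {A B : Set Ω} (hA : MeasurableSet A) (hB : MeasurableSet B)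
    (h : Disjoint A B) :
    indicatorLp P (hA.union hB) = indicatorLp P hA + indicatorLp P hB :=
  indicatorConstLp_disjoint_union hA hB _ _ h 1

/-- By additivity the partial sums differ from the total by the value of `f` on the tail unions.
These decrease to `∅`, so their probabilities, and with them the values of `f`, tend to `0`. -/
theorem hasSum_indicatorLp {f : Lp ℝ ∞ P →L[ℝ] ℝ} (hpos : ∀ u, 0 ≤ u → 0 ≤ f u)
    (hsmall : ∀ ε > 0, ∃ η > 0, ∀ (B : Set Ω) (hB : MeasurableSet B), P.real B < η →
      f (indicatorLp P hB) ≤ ε) {E : ℕ → Set Ω} (hE : ∀ i, MeasurableSet (E i))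
    (hd : Pairwise (Function.onFun Disjoint E)) :
    HasSum (fun i => f (indicatorLp P (hE i))) (f (indicatorLp P (MeasurableSet.iUnion hE))) := by
  rw [hasSum_iff_tendsto_nat_of_nonneg fun i => hpos _ (indicatorLp_nonneg _)]
  let T : ℕ → Set Ω := fun n => ⋃ i, E (n + i)
  have hT : ∀ n, MeasurableSet (T n) := fun n => MeasurableSet.iUnion fun i => hE _
  have hTE : ∀ n, T n = E n ∪ T (n + 1) := by
    intro n
    ext ω
    simp only [T, Set.mem_iUnion, Set.mem_union]
    constructor
    · rintro ⟨_ | i, hi⟩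
      · exact Or.inl hi
      · exact Or.inr ⟨i, by rwa [Nat.add_right_comm]⟩
    · rintro (h | ⟨i, hi⟩)
      · exact ⟨0, h⟩
      · exact ⟨i + 1, by rwa [Nat.add_right_comm] at hi⟩
  have hdT : ∀ n, Disjoint (E n) (T (n + 1)) := fun n =>
    Set.disjoint_iUnion_right.2 fun i => hd (by omega)
  have hsplit : ∀ n, ∑ i ∈ Finset.range n, f (indicatorLp P (hE i)) =
      f (indicatorLp P (MeasurableSet.iUnion hE)) - f (indicatorLp P (hT n)) := by
    intro n
    induction n with
    | zero => simp [T]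
    | succ n ih =>
      have : indicatorLp P (hT n) = indicatorLp P (hE n) + indicatorLp P (hT (n + 1)) := by
        rw [← indicatorLp_union (hE n) (hT (n + 1)) (hdT n)]
        congr 1
        exact hTE n
      rw [Finset.sum_range_succ, ih, this, map_add]
      ring
  have hanti : Antitone T := antitone_nat_of_succ_le fun n => by
    rw [hTE n]; exact Set.subset_union_right
  have hinter : ⋂ n, T n = ∅ := by
    rw [Set.eq_empty_iff_forall_notMem]
    intro ω hω
    rw [Set.mem_iInter] at hω
    obtain ⟨i, hi⟩ := Set.mem_iUnion.1 (hω 0)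
    obtain ⟨j, hj⟩ := Set.mem_iUnion.1 (hω (i + 1))
    exact Set.disjoint_left.1 (hd (by omega : 0 + i ≠ i + 1 + j)) hi hj
  have hPT : Tendsto (fun n => P.real (T n)) atTop (𝓝 0) := by
    have := tendsto_measure_iInter_atTop (μ := P) (fun n => (hT n).nullMeasurableSet) hanti
      ⟨0, measure_ne_top _ _⟩
    rw [hinter, measure_empty] at this
    exact (ENNReal.tendsto_toReal ENNReal.zero_ne_top).comp this
  have hfT : Tendsto (fun n => f (indicatorLp P (hT n))) atTop (𝓝 0) := by
    rw [Metric.tendsto_atTop']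
    intro ε hε
    obtain ⟨η, hη, h⟩ := hsmall (ε / 2) (half_pos hε)
    obtain ⟨N, hN⟩ := eventually_atTop.1 (hPT.eventually_lt_const hη)
    refine ⟨N, fun n hn => ?_⟩
    rw [Real.dist_0_eq_abs, abs_of_nonneg (hpos _ (indicatorLp_nonneg _))]
    linarith [h (T n) (hT n) (hN n hn.le)]
  simp only [hsplit]
  simpa using hfT.const_sub (f (indicatorLp P (MeasurableSet.iUnion hE)))

/-- Rounding `g` down to the grid `ε ℤ` takes finitely many values because `g` is bounded. -/
theorem exists_simpleFunc_abs_sub_le {g : Ω → ℝ} (hg : Measurable g) {M : ℝ}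
    (hM : ∀ ω, |g ω| ≤ M) {ε : ℝ} (hε : 0 < ε) :
    ∃ s : SimpleFunc Ω ℝ, ∀ ω, |s ω - g ω| ≤ ε := by
  have hmeas : Measurable fun ω => ⌊g ω / ε⌋ := (hg.div_const ε).floor
  have hfin : (Set.range fun ω => ⌊g ω / ε⌋).Finite := by
    refine (Set.finite_Icc ⌊-M / ε⌋ ⌊M / ε⌋).subset ?_
    rintro _ ⟨ω, rfl⟩
    have := abs_le.1 (hM ω)
    exact ⟨Int.floor_mono (by gcongr; exact this.1), Int.floor_mono (by gcongr; exact this.2)⟩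
  let s : SimpleFunc Ω ℤ := ⟨fun ω => ⌊g ω / ε⌋, fun k => hmeas (measurableSet_singleton k), hfin⟩
  refine ⟨s.map fun k : ℤ => ε * (k : ℝ), fun ω => ?_⟩
  show |ε * (⌊g ω / ε⌋ : ℝ) - g ω| ≤ ε
  have h1 := Int.floor_le (g ω / ε)
  have h2 := Int.lt_floor_add_one (g ω / ε)
  rw [le_div_iff₀ hε] at h1
  rw [div_lt_iff₀ hε] at h2
  rw [abs_le]
  constructor <;> linarith

theorem map_simpleFunc_eq_integral {f : Lp ℝ ∞ P →L[ℝ] ℝ} {μ : Measure Ω} [IsFiniteMeasure μ]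
    (h : ∀ (B : Set Ω) (hB : MeasurableSet B), f (indicatorLp P hB) = μ.real B)
    (s : SimpleFunc Ω ℝ) :
    f ((SimpleFunc.memLp_top s P).toLp s) = ∫ ω, s ω ∂μ := by
  induction s using SimpleFunc.induction with
  | const c hB =>
    rename_i B
    have : (SimpleFunc.memLp_top (SimpleFunc.piecewise B hB (SimpleFunc.const Ω c)
        (SimpleFunc.const Ω 0)) P).toLp _ = c • indicatorLp P hB := by
      refine Lp.ext ((MemLp.coeFn_toLp _).trans ?_)
      filter_upwards [Lp.coeFn_smul c (indicatorLp P hB), indicatorLp_coeFn (P := P) hB]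
        with ω h1 h2
      rw [h1, Pi.smul_apply, h2]
      by_cases hω : ω ∈ B <;> simp [hω]
    rw [this, map_smul, h, smul_eq_mul]
    simp only [SimpleFunc.coe_piecewise, SimpleFunc.coe_const, Function.const_zero,
      Set.piecewise_eq_indicator]
    rw [integral_indicator hB]
    simp [mul_comm]
  | add _ h1 h2 =>
    rename_i f' g' _
    have : (SimpleFunc.memLp_top (f' + g') P).toLp (f' + g' : SimpleFunc Ω ℝ) =
        (SimpleFunc.memLp_top f' P).toLp f' + (SimpleFunc.memLp_top g' P).toLp g' := by
      rw [← MemLp.toLp_add]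
      rfl
    rw [this, map_add, h1, h2, ← integral_add]
    · rfl
    · exact SimpleFunc.integrable_of_isFiniteMeasure _
    · exact SimpleFunc.integrable_of_isFiniteMeasure _

/-- Both sides are continuous for the sup norm and agree on simple functions, which are dense. -/
theorem map_eq_integral {f : Lp ℝ ∞ P →L[ℝ] ℝ} {μ : Measure Ω} [IsFiniteMeasure μ]
    (hμ : μ ≪ P) (h : ∀ (B : Set Ω) (hB : MeasurableSet B), f (indicatorLp P hB) = μ.real B)
    (u : Lp ℝ ∞ P) : f u = ∫ ω, u ω ∂μ := by
  -- A representative bounded everywhere, not just a.s., as the uniform approximation requires.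
  let g : Ω → ℝ := fun ω => max (-‖u‖) (min (u ω) ‖u‖)
  have hg : Measurable g :=
    measurable_const.max ((Lp.stronglyMeasurable u).measurable.min measurable_const)
  have hgM : ∀ ω, |g ω| ≤ ‖u‖ := fun ω =>
    abs_le.2 ⟨le_max_left _ _, max_le (by linarith [norm_nonneg u]) (min_le_right _ _)⟩
  have hgu : g =ᵐ[P] u := by
    filter_upwards [ae_abs_le_norm u] with ω hω
    have := abs_le.1 hω
    simp only [g]
    rw [min_eq_left this.2, max_eq_right this.1]
  have key : ∀ ε > 0, |f u - ∫ ω, u ω ∂μ| ≤ (‖f‖ + μ.real Set.univ) * ε := by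
    intro ε hε
    obtain ⟨s, hs⟩ := exists_simpleFunc_abs_sub_le hg hgM hε
    have hsm := SimpleFunc.memLp_top s P
    have hsu : ∀ᵐ ω ∂P, |s ω - u ω| ≤ ε := by
      filter_upwards [hgu] with ω hω
      rw [← hω]; exact hs ω
    have hnorm : ‖hsm.toLp s - u‖ ≤ ε := by
      have := Lp.norm_le_of_ae_bound (f := hsm.toLp s - u) hε.le (by
        filter_upwards [hsu, Lp.coeFn_sub (hsm.toLp s) u, hsm.coeFn_toLp] with ω h1 h2 h3
        rwa [h2, Pi.sub_apply, h3])
      simpa using this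
    have h1 : |f (hsm.toLp s) - f u| ≤ ‖f‖ * ε := by
      rw [← map_sub]
      exact (f.le_opNorm _).trans (by gcongr)
    have h2 : |∫ ω, s ω ∂μ - ∫ ω, u ω ∂μ| ≤ ε * μ.real Set.univ := by
      rw [← integral_sub (SimpleFunc.integrable_of_isFiniteMeasure _) (integrable_of_ac hμ u)]
      have hsμ : ∀ᵐ ω ∂μ, ‖s ω - u ω‖ ≤ ε := hμ.ae_le hsu
      exact norm_integral_le_of_norm_le_const hsμ
    rw [map_simpleFunc_eq_integral h] at h1
    rw [abs_le] at h1 h2 ⊢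
    constructor <;> linarith
  by_contra hne
  have hpos : 0 < |f u - ∫ ω, u ω ∂μ| := abs_pos.2 (sub_ne_zero.2 hne)
  have hC : 0 ≤ ‖f‖ + μ.real Set.univ := add_nonneg (norm_nonneg _) measureReal_nonneg
  set a := |f u - ∫ ω, u ω ∂μ|
  have h1 := key (a / (2 * (‖f‖ + μ.real Set.univ + 1))) (by positivity)
  rw [mul_div_assoc', le_div_iff₀ (by positivity)] at h1
  nlinarith

/-- A positive functional on `L^∞` that is absolutely continuous on indicators is given by
integration with respect to a finite measure absolutely continuous with respect to `P`. -/
theorem exists_measure_map_eq_integral {f : Lp ℝ ∞ P →L[ℝ] ℝ} (hpos : ∀ u, 0 ≤ u → 0 ≤ f u)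
    (hsmall : ∀ ε > 0, ∃ η > 0, ∀ (B : Set Ω) (hB : MeasurableSet B), P.real B < η →
      f (indicatorLp P hB) ≤ ε) :
    ∃ μ : Measure Ω, IsFiniteMeasure μ ∧ μ ≪ P ∧ ∀ u, f u = ∫ ω, u ω ∂μ := by
  let μ : Measure Ω := Measure.ofMeasurable
    (fun B hB => ENNReal.ofReal (f (indicatorLp P hB)))
    (by rw [indicatorLp_eq_zero _ measure_empty]; simp)
    (fun E hE hd => by
      have := hasSum_indicatorLp hpos hsmall hE hd
      rw [← this.tsum_eq]
      exact ENNReal.ofReal_tsum_of_nonneg (fun i => hpos _ (indicatorLp_nonneg _)) this.summable)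
  have hμ : ∀ (B : Set Ω) (hB : MeasurableSet B), μ B = ENNReal.ofReal (f (indicatorLp P hB)) :=
    fun B hB => Measure.ofMeasurable_apply B hB
  have hfin : IsFiniteMeasure μ := ⟨by rw [hμ _ MeasurableSet.univ]; exact ENNReal.ofReal_lt_top⟩
  have hac : μ ≪ P := Measure.AbsolutelyContinuous.mk fun B hB h => by
    rw [hμ _ hB, indicatorLp_eq_zero hB h]; simp
  refine ⟨μ, hfin, hac, map_eq_integral hac fun B hB => ?_⟩
  rw [measureReal_def, hμ B hB, ENNReal.toReal_ofReal (hpos _ (indicatorLp_nonneg _))]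

/-- Strict separation of a point from a convex set of essentially bounded functions that is
downward closed and closed under bounded almost sure convergence, by a probability measure. -/
theorem exists_separating_acProb {A : Set (Lp ℝ ∞ P)} (hconv : Convex ℝ A)
    (hlow : IsLowerSet A) (hcl : IsBddAEClosed A) {x : Lp ℝ ∞ P} (hx : x ∉ A) :
    ∃ (Q : ACProb P) (s : ℝ), s < ∫ ω, x ω ∂Q.meas ∧ ∀ z ∈ A, ∫ ω, z ω ∂Q.meas ≤ s := by
  rcases A.eq_empty_or_nonempty with rfl | ⟨z₀, hz₀⟩
  -- With `A` empty any probability works; `P` itself is taken.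
  · exact ⟨⟨⟨P, inferInstance⟩, Measure.AbsolutelyContinuous.rfl⟩, _, sub_one_lt _, by simp⟩
  let D : Set (Lp ℝ ∞ P) := {u | x - u ∈ A}
  have hDconv : Convex ℝ D := by
    intro u hu v hv s t hs ht hst
    show x - (s • u + t • v) ∈ A
    have : x - (s • u + t • v) = s • (x - u) + t • (x - v) := by
      rw [smul_sub, smul_sub, sub_add_sub_comm, ← add_smul, hst, one_smul]
    rw [this]
    exact hconv hu hv hs ht hst
  have hDup : IsUpperSet D := fun u v huv hu => hlow (sub_le_sub_left huv x) hu
  have hDcl : IsBddAEClosed D := by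
    intro M u v hM hv hu
    refine hcl (‖x‖ + M) (fun n => x - u n) (x - v) (fun n => ?_) ?_ hu
    · filter_upwards [hM n, ae_abs_le_norm x, Lp.coeFn_sub x (u n)] with ω h1 h2 h3
      rw [h3]
      exact (abs_sub _ _).trans (add_le_add h2 h1)
    · filter_upwards [hv, Lp.coeFn_sub x v, ae_all_iff.2 fun n => Lp.coeFn_sub x (u n)]
        with ω h1 h2 h3
      simp only [h2, h3, Pi.sub_apply]
      exact h1.const_sub _
  obtain ⟨δ, hδ, hdisj⟩ := exists_disjoint_excessSet hDconv hDup hDcl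
    (show x - 0 ∉ A by rwa [sub_zero])
  obtain ⟨f, c, hc, hfV, hfD⟩ := exists_separating_functional hDconv hδ hdisj
  obtain ⟨μ, hfin, hac, hfμ⟩ := exists_measure_map_eq_integral
    (fun u hu => nonneg_of_le_on_excessSet hδ hc hfV hu)
    (fun ε hε => indicatorLp_small_of_le_on_excessSet hδ hc hfV hε)
  -- Normalization needs `μ ≠ 0`: since `x - z₀ ∈ D`, its integral is at least `c > 0`.
  have hne : NeZero μ := ⟨by
    rintro rfl
    have := hfD (x - z₀) (show x - (x - z₀) ∈ A by rwa [sub_sub_cancel])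
    rw [hfμ, integral_zero_measure] at this
    linarith⟩
  let Q : ACProb P := ⟨⟨(μ Set.univ)⁻¹ • μ, inferInstance⟩, hac.smul_left _⟩
  have hQ : ∀ u : Lp ℝ ∞ P, ∫ ω, u ω ∂Q.meas = (μ Set.univ)⁻¹.toReal * f u := fun u => by
    rw [hfμ]
    exact integral_smul_measure _ _
  have hr : 0 < (μ Set.univ)⁻¹.toReal :=
    ENNReal.toReal_pos (ENNReal.inv_ne_zero.2 (measure_ne_top _ _))
      (ENNReal.inv_ne_top.2 (NeZero.ne _))
  -- For `z ∈ A` the bound `f (x - z) ≥ c` reads `f z ≤ f x - c`; the positive `c` is what makes the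
  -- separation strict.
  refine ⟨Q, (μ Set.univ)⁻¹.toReal * (f x - c), ?_, fun z hz => ?_⟩
  · rw [hQ]
    exact mul_lt_mul_of_pos_left (by linarith) hr
  · rw [hQ]
    have := hfD (x - z) (show x - (x - z) ∈ A by rwa [sub_sub_cancel])
    rw [map_sub] at this
    exact mul_le_mul_of_nonneg_left (by linarith) hr.le

end QuasiLogconvex

/-! ### Level sets in logarithmic coordinates and the dual representation. -/

namespace QuasiLogconvex

variable {Ω : Type*} [MeasurableSpace Ω] {P : Measure Ω} [IsProbabilityMeasure P]

/-- The exponential map from `L^∞` to `L^∞_{++}`. -/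
noncomputable def expLp (u : Lp ℝ ∞ P) : LInftyPP P :=
  LInftyPP.mk (fun ω => Real.exp (u ω))
    (Real.continuous_exp.comp_aestronglyMeasurable (Lp.aestronglyMeasurable u))
    ⟨Real.exp (-‖u‖), Real.exp ‖u‖, Real.exp_pos _, by
      filter_upwards [ae_abs_le_norm u] with ω h
      have := abs_le.1 h
      exact ⟨Real.exp_le_exp.2 this.1, Real.exp_le_exp.2 this.2⟩⟩

theorem expLp_rv (u : Lp ℝ ∞ P) : (expLp u).rv =ᵐ[P] fun ω => Real.exp (u ω) :=
  LInftyPP.mk_rv _ _ _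

theorem exists_expLp_eq (X : LInftyPP P) : ∃ u : Lp ℝ ∞ P, expLp u = X := by
  obtain ⟨M, hM⟩ := exists_abs_log_rv_le X
  have hmem : MemLp (fun ω => Real.log (X.rv ω)) ∞ P :=
    memLp_top_of_bound (aemeasurable_log_rv X).aestronglyMeasurable M hM
  refine ⟨hmem.toLp _, rv_ext ?_⟩
  filter_upwards [expLp_rv (hmem.toLp _), hmem.coeFn_toLp, rv_pos X] with ω h1 h2 h3
  rw [h1, h2, Real.exp_log h3]

theorem expLog_expLp (Q : ACProb P) (u : Lp ℝ ∞ P) : expLog Q (expLp u) = ∫ ω, u ω ∂Q.meas := by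
  refine integral_congr_ae (Q.ac.ae_le ?_)
  filter_upwards [expLp_rv u] with ω h
  rw [h, Real.log_exp]

theorem expLp_rv_le {u v : Lp ℝ ∞ P} (h : ∀ᵐ ω ∂P, u ω ≤ v ω) :
    (expLp u).rv ≤ᵐ[P] (expLp v).rv := by
  filter_upwards [expLp_rv u, expLp_rv v, h] with ω h1 h2 h3
  rw [h1, h2]
  exact Real.exp_le_exp.2 h3

theorem geomMean_expLp (u v : Lp ℝ ∞ P) (α : Set.Ioo (0 : ℝ) 1) :
    geomMean (expLp u) (expLp v) α = expLp ((α : ℝ) • u + (1 - α : ℝ) • v) := by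
  refine rv_ext ?_
  have h : (geomMean (expLp u) (expLp v) α).rv =ᵐ[P] _ := LInftyPP.mk_rv _ _ _
  filter_upwards [h, expLp_rv u, expLp_rv v, expLp_rv ((α : ℝ) • u + (1 - α : ℝ) • v),
    Lp.coeFn_add ((α : ℝ) • u) ((1 - α : ℝ) • v), Lp.coeFn_smul (α : ℝ) u,
    Lp.coeFn_smul (1 - α : ℝ) v] with ω h1 h2 h3 h4 h5 h6 h7
  rw [h1, h2, h3, h4, h5, Pi.add_apply, h6, h7, ← Real.exp_mul, ← Real.exp_mul, ← Real.exp_add]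
  simp only [Pi.smul_apply, smul_eq_mul, mul_comm]

/-- Tail infima replace a convergent sequence by an increasing one with the same limit, to which
continuity from below applies. -/
theorem tendsto_iInf_add {a : ℕ → ℝ} {l : ℝ} (hb : BddBelow (Set.range a))
    (h : Tendsto a atTop (𝓝 l)) :
    Monotone (fun n => ⨅ m, a (n + m)) ∧ Tendsto (fun n => ⨅ m, a (n + m)) atTop (𝓝 l) := by
  have hb' : ∀ n, BddBelow (Set.range fun m => a (n + m)) := fun n =>
    hb.mono (by rintro _ ⟨m, rfl⟩; exact ⟨n + m, rfl⟩)
  have hle : ∀ n, ⨅ m, a (n + m) ≤ a n := fun n => ciInf_le (hb' n) 0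
  refine ⟨monotone_nat_of_le_succ fun n => le_ciInf fun m => ?_, ?_⟩
  · have := ciInf_le (hb' n) (1 + m)
    rwa [← add_assoc] at this
  · refine tendsto_order.2 ⟨fun y hy => ?_, fun y hy => ?_⟩
    · obtain ⟨z, hyz, hzl⟩ := exists_between hy
      obtain ⟨N, hN⟩ := eventually_atTop.1 (h.eventually_const_lt hzl)
      filter_upwards [eventually_ge_atTop N] with n hn
      exact hyz.trans_le (le_ciInf fun m => (hN _ (by omega)).le)
    · filter_upwards [h.eventually_lt_const hy] with n hn using (hle n).trans_lt hn

variable {ρ : LInftyPP P → ℝ≥0∞}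

theorem convex_logLevelSet (hq : IsQuasiLogconvex ρ) (c : ℝ≥0∞) :
    Convex ℝ {u : Lp ℝ ∞ P | ρ (expLp u) ≤ c} := by
  refine convex_iff_forall_pos.2 fun u hu v hv s t hs ht hst => ?_
  obtain rfl : t = 1 - s := by linarith
  have := hq (expLp u) (expLp v) ⟨s, hs, by linarith⟩
  rw [geomMean_expLp] at this
  exact this.trans (max_le hu hv)

theorem isLowerSet_logLevelSet (hm : IsMonotone ρ) (c : ℝ≥0∞) :
    IsLowerSet {u : Lp ℝ ∞ P | ρ (expLp u) ≤ c} := fun u v hvu hu =>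
  (hm _ _ (expLp_rv_le ((Lp.coeFn_le v u).2 hvu))).trans hu

/-- The Fatou property of monotone functionals that are continuous from below. -/
theorem isBddAEClosed_logLevelSet (hm : IsMonotone ρ) (hc : IsContinuousFromBelow ρ) (c : ℝ≥0∞) :
    IsBddAEClosed {u : Lp ℝ ∞ P | ρ (expLp u) ≤ c} := by
  intro M u v hM hv hu
  have hM' : ∀ᵐ ω ∂P, ∀ n, |u n ω| ≤ M := ae_all_iff.2 hM
  have hmem : ∀ n, MemLp (fun ω => ⨅ m, u (n + m) ω) ∞ P := fun n => by
    refine memLp_top_of_bound (AEMeasurable.iInf fun m =>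
      (Lp.aestronglyMeasurable (u (n + m))).aemeasurable).aestronglyMeasurable M ?_
    filter_upwards [hM'] with ω h
    have hb : BddBelow (Set.range fun m => u (n + m) ω) :=
      ⟨-M, by rintro _ ⟨m, rfl⟩; exact (abs_le.1 (h _)).1⟩
    exact abs_le.2 ⟨le_ciInf fun m => (abs_le.1 (h _)).1,
      (ciInf_le hb 0).trans (abs_le.1 (h _)).2⟩
  -- The tail infima `w n` increase to `v` and lie below `u n`, so monotonicity keeps them in the
  -- level set and continuity from below passes to the limit.
  let w : ℕ → Lp ℝ ∞ P := fun n => (hmem n).toLp _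
  have hw : ∀ᵐ ω ∂P, ∀ n, w n ω = ⨅ m, u (n + m) ω := ae_all_iff.2 fun n => (hmem n).coeFn_toLp
  have hbdd : ∀ᵐ ω ∂P, BddBelow (Set.range fun n => u n ω) := by
    filter_upwards [hM'] with ω h
    exact ⟨-M, by rintro _ ⟨m, rfl⟩; exact (abs_le.1 (h _)).1⟩
  refine le_of_tendsto' (hc (fun n => expLp (w n)) (expLp v) ?_) fun n =>
    (hm _ _ (expLp_rv_le ?_)).trans (hu n)
  · filter_upwards [hw, hbdd, hv, expLp_rv v, ae_all_iff.2 fun n => expLp_rv (w n)]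
      with ω h1 h2 h3 h4 h5
    obtain ⟨h6, h7⟩ := tendsto_iInf_add h2 h3
    simp only [h4, h5, h1]
    exact ⟨Real.exp_monotone.comp h6, (Real.continuous_exp.tendsto _).comp h7⟩
  · filter_upwards [hw, hbdd] with ω h1 h2
    rw [h1]
    exact ciInf_le (h2.mono (by rintro _ ⟨m, rfl⟩; exact ⟨n + m, rfl⟩)) 0

theorem exists_expLog_separation (hm : IsMonotone ρ) (hq : IsQuasiLogconvex ρ)
    (hc : IsContinuousFromBelow ρ) {X : LInftyPP P} {c : ℝ≥0∞} (hX : c < ρ X) :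
    ∃ (Q : ACProb P) (s : ℝ), s < expLog Q X ∧ ∀ Y, ρ Y ≤ c → expLog Q Y ≤ s := by
  obtain ⟨x, rfl⟩ := exists_expLp_eq X
  obtain ⟨Q, s, hs, hQ⟩ := exists_separating_acProb (convex_logLevelSet hq c)
    (isLowerSet_logLevelSet hm c) (isBddAEClosed_logLevelSet hm hc c) (not_le.2 hX)
  refine ⟨Q, s, by rwa [expLog_expLp], fun Y hY => ?_⟩
  obtain ⟨y, rfl⟩ := exists_expLp_eq Y
  rw [expLog_expLp]
  exact hQ y hY

/-- For each `c < ρ X`, separating `log X` from the level set of `c` gives a `Q` whose term is at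
least `c`. -/
theorem le_iSup_exp_leftReg_dualFn (hm : IsMonotone ρ) (hq : IsQuasiLogconvex ρ)
    (hc : IsContinuousFromBelow ρ) (X : LInftyPP P) :
    ρ X ≤ ⨆ Q : ACProb P, EReal.exp (leftReg (dualFn ρ) (expLog Q X) Q) := by
  refine le_of_forall_lt_imp_le_of_dense fun c hcX => ?_
  obtain ⟨Q, s, hs, hQ⟩ := exists_expLog_separation hm hq hc hcX
  -- The strict gap leaves room for an `s'` strictly below `E_Q[log X]`, as the left limit demands.
  -- Any `Y` with `E_Q[log Y] ≥ s' > s` violates `ρ Y ≤ c`.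
  obtain ⟨s', hs', hs''⟩ := exists_between hs
  refine le_iSup_of_le Q ?_
  rw [← ENNReal.exp_log c]
  refine EReal.expOrderIso.monotone (le_iSup₂_of_le s' hs'' (le_iInf₂ fun Y hY => ?_))
  refine ENNReal.logOrderIso.monotone (le_of_not_ge fun h => ?_)
  exact absurd (hQ Y h) (not_le.2 (hs'.trans_le hY))

theorem representedBy_leftReg_dualFn (hm : IsMonotone ρ) (hq : IsQuasiLogconvex ρ)
    (hc : IsContinuousFromBelow ρ) : RepresentedBy ρ (leftReg (dualFn ρ)) := fun X =>
  le_antisymm (le_iSup_exp_leftReg_dualFn hm hq hc X) (iSup_le fun Q =>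
    (EReal.expOrderIso.monotone (leftReg_dualFn_le ρ _ Q)).trans (exp_dualFn_le ρ X Q))

theorem representedBy_dualFn (hm : IsMonotone ρ) (hq : IsQuasiLogconvex ρ)
    (hc : IsContinuousFromBelow ρ) : RepresentedBy ρ (dualFn ρ) := fun X =>
  le_antisymm ((le_iSup_exp_leftReg_dualFn hm hq hc X).trans
    (iSup_mono fun Q => EReal.expOrderIso.monotone (leftReg_dualFn_le ρ _ Q)))
    (iSup_le fun Q => exp_dualFn_le ρ X Q)

/-- The left-limit version serves as witness because it is continuous from below by construction. -/
theorem regular_iff_exists_representedBy (ρ : LInftyPP P → ℝ≥0∞) :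
    (IsMonotone ρ ∧ IsQuasiLogconvex ρ ∧ IsContinuousFromBelow ρ) ↔
      ∃ N : ℝ → ACProb P → EReal,
        (∀ Q, Monotone (fun t => N t Q) ∧ ContFromBelow (fun t => N t Q)) ∧ RepresentedBy ρ N :=
  ⟨fun ⟨hm, hq, hc⟩ => ⟨leftReg (dualFn ρ),
    fun Q => ⟨leftReg_mono _ Q, leftReg_contFromBelow _ Q⟩,
    representedBy_leftReg_dualFn hm hq hc⟩, fun ⟨_, hN, h⟩ => h.regularity hN⟩

end QuasiLogconvex

theorem mainTheorem1 {Ω : Type*} [MeasurableSpace Ω] (P : Measure Ω) [IsProbabilityMeasure P]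
    (ρ : QuasiLogconvex.LInftyPP P → ℝ≥0∞) :
    -- equivalence with the representation through some `𝔑`
    ((QuasiLogconvex.IsMonotone ρ ∧ QuasiLogconvex.IsQuasiLogconvex ρ ∧
        QuasiLogconvex.IsContinuousFromBelow ρ) ↔
      ∃ N : ℝ → QuasiLogconvex.ACProb P → EReal,
        (∀ Q, Monotone (fun t => N t Q) ∧ QuasiLogconvex.ContFromBelow (fun t => N t Q)) ∧
        QuasiLogconvex.RepresentedBy ρ N) ∧
    -- the explicit functional represents `ρ`, and so does its left-limit version
    ((QuasiLogconvex.IsMonotone ρ ∧ QuasiLogconvex.IsQuasiLogconvex ρ ∧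
        QuasiLogconvex.IsContinuousFromBelow ρ) →
      QuasiLogconvex.RepresentedBy ρ (QuasiLogconvex.dualFn ρ) ∧
      (∀ Q, Monotone (fun t => QuasiLogconvex.dualFn ρ t Q)) ∧
      QuasiLogconvex.RepresentedBy ρ (QuasiLogconvex.leftReg (QuasiLogconvex.dualFn ρ)) ∧
      (∀ Q, Monotone (fun t => QuasiLogconvex.leftReg (QuasiLogconvex.dualFn ρ) t Q) ∧
        QuasiLogconvex.ContFromBelow
          (fun t => QuasiLogconvex.leftReg (QuasiLogconvex.dualFn ρ) t Q))) ∧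
    -- equivalence with the representation through some `R` and the Orlicz premia
    ((QuasiLogconvex.IsMonotone ρ ∧ QuasiLogconvex.IsQuasiLogconvex ρ ∧
        QuasiLogconvex.IsContinuousFromBelow ρ) ↔
      ∃ R : Set.Ioi (0 : ℝ) → QuasiLogconvex.ACProb P → ℝ≥0∞,
        (∀ Q, Monotone (fun s => R s Q) ∧ QuasiLogconvex.ContFromBelow (fun s => R s Q)) ∧
        QuasiLogconvex.OrliczRepresentedBy ρ R) ∧
    -- the two kinds of representation correspond through `R(s; Q) = exp (𝔑(log s; Q))`
    (∀ N : ℝ → QuasiLogconvex.ACProb P → EReal,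
      QuasiLogconvex.RepresentedBy ρ N ↔
        QuasiLogconvex.OrliczRepresentedBy ρ
          (fun s Q => EReal.exp (N (Real.log (s : ℝ)) Q))) := by
  refine ⟨QuasiLogconvex.regular_iff_exists_representedBy ρ, fun ⟨hm, hq, hc⟩ => ?_, ?_,
    QuasiLogconvex.representedBy_iff_orliczRepresentedBy ρ⟩
  · exact ⟨QuasiLogconvex.representedBy_dualFn hm hq hc, QuasiLogconvex.dualFn_mono ρ,
      QuasiLogconvex.representedBy_leftReg_dualFn hm hq hc, fun Q =>
        ⟨QuasiLogconvex.leftReg_mono _ Q, QuasiLogconvex.leftReg_contFromBelow _ Q⟩⟩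
  · rw [QuasiLogconvex.regular_iff_exists_representedBy]
    exact ⟨fun ⟨_, hN, h⟩ => h.exists_orliczRepresentedBy hN,
      fun ⟨_, hR, h⟩ => h.exists_representedBy hR⟩
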